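/- **Impossibility of consensus without active accountability.** *Model.* A committee of $n\ge 2$ processes runs a message-passing protocol $\sigma$ with proposals and decisions in a set $V$ with at least two values. The network is reliable, authenticated and partially synchronous: a message sent at time $s$ is delivered after time $s$ and no later than $\max(s,\mathrm{GST})+\Delta$, where $\Delta\ge 1$ is known and $\mathrm{GST}$ is not. Processes have a public-key infrastructure with (ideal) unforgeable signatures and may use private random seeds. $\sigma$ *solves consensus* in an execution if every non-faulty process eventually decides (termination), no two non-faulty processes decide different values (agreement), and, whenever all non-faulty processes propose the same value, none of them decides another value (validity). *Faults.* A static adversary chooses disjoint sets of at most $t$ Byzantine, $d$ deceitful and $q$ benign processes, and splits the processes into camps. - Byzantine processes act arbitrarily and share their keys and received messages with each other; they cannot forge signatures of other processes. - A deceitful process equivocates between the camps and does not deviate from $\sigma$ in any other way: it runs one copy of $\sigma$ for each camp (possibly with different proposals, seeds and message delays within the above bounds), and sends to each camp only the messages of its copy for that camp; each copy receives what other processes send to the deceitful process, where other deceitful processes are represented by their copy for the same camp. - A benign process may deviate in any way (crash, send stale or invalid messages, etc.), without forging signatures of others, but never sends two *conflicting* messages, that is, messages $m,m'$ each of which it could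 have sent as a non-faulty process in some execution of $\sigma$, but not both in the same execution, and such that sending both contributes to a disagreement: in some execution with a disagreement the process is faulty and sends $m$ and $m'$ to two different non-faulty processes, and there is no disagreement if it leaves $m,m'$ out and the adversary acts in the same way otherwise. Let $E_\sigma(t,d,q)$ be the set of all executions of $\sigma$ with up to $t$ Byzantine, $d$ deceitful and $q$ benign processes. $\sigma$ *tolerates* $t$ Byzantine, $d$ deceitful and $q$ benign processes if it solves consensus in all executions in $E_\sigma(t,d,q)$. *Active accountability* says that deceitful behaviour does not prevent termination. Accordingly, $\sigma$ *does not satisfy active accountability* (for $t,d,q$) if deceitful faults can prevent termination just as benign faults can: if some execution in $E_\sigma(t,0,q+d)$, where the $d$ processes are benign instead of deceitful, does not terminate, then some execution in $E_\sigma(t,d,q)$ does not terminate. (This includes every protocol that has a non-terminating execution in $E_\sigma(t,d,q)$.) *Statement.* Let $n\ge 2$ and let $t,d,q\ge 0$ satisfy $n\le 3(t+d)+2q$. Then no protocol $\sigma$ that does not satisfy active accountability for $t,d,q$ tolerates $t$ Byzantine, $d$ deceitful and $q$ benign processes. -/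

import Mathlib

universe u

namespace BDB

/-- Messages over raw data `D`, with idealised public-key signatures of the `n` processes:
`signed i a` is `a` together with a valid signature of process `i`. -/
inductive Message (n : ℕ) (D : Type u) : Type u
  | data (x : D) : Message n D
  | pair (a b : Message n D) : Message n D
  | signed (i : Fin n) (a : Message n D) : Message n D

/-- `Derivable K S m`: whoever holds the private keys of the processes in `K` and has received the
messages in `S` can construct `m`. Signatures can be read and forwarded by everybody, but created
only with the private key. -/
inductive Derivable {n : ℕ} {D : Type u} (K : Set (Fin n)) (S : Set (Message n D)) :
    Message n D → Prop
  | received {m : Message n D} : m ∈ S → Derivable K S m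
  | data (x : D) : Derivable K S (.data x)
  | pair {a b : Message n D} : Derivable K S a → Derivable K S b → Derivable K S (.pair a b)
  | fst {a b : Message n D} : Derivable K S (.pair a b) → Derivable K S a
  | snd {a b : Message n D} : Derivable K S (.pair a b) → Derivable K S b
  | content {i : Fin n} {a : Message n D} : Derivable K S (.signed i a) → Derivable K S a
  | sign {i : Fin n} {a : Message n D} : i ∈ K → Derivable K S a → Derivable K S (.signed i a)

/-- What a process receives at one time step, by (authenticated) sender. -/
abbrev Inbox (n : ℕ) (D : Type u) : Type u := Fin n → Multiset (Message n D)

/-- A message-passing protocol for `n` processes with proposals and decisions in `V`. At each time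
step a process sends messages, and possibly decides, as a function of its identity, its proposal,
its private random seed, and everything it has received so far (the list of its inboxes at times
`0, 1, …, s`). A process signs only with its own key. -/
structure Protocol (n : ℕ) (V : Type u) where
  /-- Raw message contents. -/
  Data : Type u
  /-- Private random seeds. -/
  Seed : Type u
  seed_nonempty : Nonempty Seed
  /-- `send p v r h j`: the messages that `p` sends to `j`. -/
  send : Fin n → V → Seed → List (Inbox n Data) → Fin n → Multiset (Message n Data)
  /-- The decision that `p` takes, if any. -/
  decide : Fin n → V → Seed → List (Inbox n Data) → Option V
  send_derivable : ∀ p v r h j, ∀ m ∈ send p v r h j,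
    Derivable {p} {m' | ∃ b ∈ h, ∃ i, m' ∈ b i} m

variable {n : ℕ} {V : Type u}

/-- The raw data of an execution.

The processes are split into camps by the adversary. A faulty process may treat the camps
differently: `sent p c s j` are the messages that `p` sends to `j` at time `s` in its dealings with
camp `c`. A process `j` that is not faulty belongs to the single camp `camp j`, so what it gets from
`p` is `sent p (camp j) s j`; a faulty process may take part in the dealings of every camp. A
process that is not faulty sends the same on all camps (see `IsRun`). The message `m` that is sent
at time `s` by `i` to `p` for camp `c` is delivered at time `delivery i s p c m`. -/
structure Trace (σ : Protocol n V) where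
  faulty : Finset (Fin n)
  camp : Fin n → Fin n
  input : Fin n → V
  seed : Fin n → σ.Seed
  /-- The global stabilization time. -/
  gst : ℕ
  sent : Fin n → Fin n → ℕ → Fin n → Multiset (Message n σ.Data)
  delivery : Fin n → ℕ → Fin n → Fin n → Message n σ.Data → ℕ

namespace Trace

variable {σ : Protocol n V}

/-- What is delivered to `p` at time `s` in the dealings of camp `c`. -/
def inbox (T : Trace σ) (p c : Fin n) (s : ℕ) : Inbox n σ.Data := fun i =>
  (Multiset.range s).bind fun s' =>
    (T.sent i c s' p).filter fun m => T.delivery i s' p c m = s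

/-- All that is delivered to `p` up to and including time `s` in the dealings of camp `c`. -/
def history (T : Trace σ) (p c : Fin n) (s : ℕ) : List (Inbox n σ.Data) :=
  (List.range (s + 1)).map (T.inbox p c)

/-- The messages that the members of `P` have received up to time `s`. -/
def received (T : Trace σ) (P : Set (Fin n)) (s : ℕ) : Set (Message n σ.Data) :=
  {m | ∃ p ∈ P, ∃ c, ∃ s' ≤ s, ∃ i, m ∈ T.inbox p c s' i}

/-- What process `p`, if it follows the protocol, decides at time `s`, if anything. -/
def decision (T : Trace σ) (p : Fin n) (s : ℕ) : Option V :=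
  σ.decide p (T.input p) (T.seed p) (T.history p (T.camp p) s)

/-- Process `p` decides `v`: this is its first decision (later ones are void). -/
def Decides (T : Trace σ) (p : Fin n) (v : V) : Prop :=
  ∃ s, T.decision p s = some v ∧ ∀ s' < s, T.decision p s' = none

/-- Every non-faulty process eventually decides. -/
def Termination (T : Trace σ) : Prop := ∀ p ∉ T.faulty, ∃ v, T.Decides p v

/-- No two non-faulty processes decide on different values. -/
def Agreement (T : Trace σ) : Prop :=
  ∀ p ∉ T.faulty, ∀ p' ∉ T.faulty, ∀ v v', T.Decides p v → T.Decides p' v' → v = v'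

/-- If all non-faulty processes propose the same value, no other value can be decided. -/
def Validity (T : Trace σ) : Prop :=
  ∀ v, (∀ p ∉ T.faulty, T.input p = v) → ∀ p ∉ T.faulty, ∀ w, T.Decides p w → w = v

/-- `p` follows the protocol. -/
def Follows (T : Trace σ) (p : Fin n) : Prop :=
  ∀ c s j, T.sent p c s j = σ.send p (T.input p) (T.seed p) (T.history p (T.camp p) s) j

/-- `T` is a possible execution of `σ`, with arbitrary behaviour of the faulty processes: the
network is partially synchronous and reliable with known delay bound `Δ` after the global
stabilization time, non-faulty processes follow the protocol, and faulty processes do not forge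
signatures of non-faulty ones. -/
structure IsRun (Δ : ℕ) (T : Trace σ) : Prop where
  causal : ∀ i s p c m, s < T.delivery i s p c m
  partially_synchronous : ∀ i s p c m, T.delivery i s p c m ≤ max s T.gst + Δ
  follows : ∀ p ∉ T.faulty, T.Follows p
  unforgeable : ∀ p ∈ T.faulty, ∀ c s j, ∀ m ∈ T.sent p c s j,
    Derivable (T.faulty : Set (Fin n)) (T.received T.faulty s) m

/-- `p` sends `m` to some process at some time. -/
def Sends (T : Trace σ) (p : Fin n) (m : Message n σ.Data) : Prop :=
  ∃ c s j, m ∈ T.sent p c s j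

/-- The set of messages `M`, sent by `p`, conforms to the run `T`: `p` sends them in `T` although
it is not faulty there. -/
def Conforms (T : Trace σ) (p : Fin n) (M : Set (Message n σ.Data)) : Prop :=
  p ∉ T.faulty ∧ ∀ m ∈ M, T.Sends p m

/-- `T'` is `T` with the messages `m` and `m'` of `p` left out, and with the same faulty behaviour
otherwise. -/
def Omits (T T' : Trace σ) (p : Fin n) (m m' : Message n σ.Data) : Prop :=
  T'.faulty = T.faulty ∧ T'.camp = T.camp ∧ T'.input = T.input ∧ T'.seed = T.seed ∧
  T'.gst = T.gst ∧ T'.delivery = T.delivery ∧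
  (∀ i ∈ T.faulty, i ≠ p → T'.sent i = T.sent i) ∧
  (∀ c s j x, x ≠ m → x ≠ m' → (open Classical in
    (T'.sent p c s j).count x = (T.sent p c s j).count x)) ∧
  ¬ T'.Sends p m ∧ ¬ T'.Sends p m'

end Trace

/-- A faulty `p` sending `m` and `m'` contributes to a disagreement: there is a run with a
disagreement in which `p` (and possibly other faulty processes) sends `m` and `m'` to different
non-faulty processes, one to each, and without `p` sending `m` and `m'` there is no disagreement. -/
def Contributes (σ : Protocol n V) (Δ : ℕ) (p : Fin n) (m m' : Message n σ.Data) : Prop :=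
  ∃ T T' : Trace σ, T.IsRun Δ ∧ T'.IsRun Δ ∧ p ∈ T.faulty ∧
    (∃ j ∉ T.faulty, ∃ j' ∉ T.faulty, j ≠ j' ∧
      (∃ s, m ∈ T.sent p (T.camp j) s j) ∧ ∃ s, m' ∈ T.sent p (T.camp j') s j') ∧
    T.Omits T' p m m' ∧ ¬ T.Agreement ∧ T'.Agreement

/-- Two messages of `p` are conflicting: each of them conforms to a run, the two together conform
to none, and sending both contributes to a disagreement. -/
def Conflicting (σ : Protocol n V) (Δ : ℕ) (p : Fin n) (m m' : Message n σ.Data) : Prop :=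
  (∃ T : Trace σ, T.IsRun Δ ∧ T.Conforms p {m}) ∧
  (∃ T : Trace σ, T.IsRun Δ ∧ T.Conforms p {m'}) ∧
  (¬ ∃ T : Trace σ, T.IsRun Δ ∧ T.Conforms p {m, m'}) ∧
  Contributes σ Δ p m m'

namespace Trace

variable {σ : Protocol n V}

/-- `p` behaves as a member of the Byzantine coalition `B`: it sends anything that can be
constructed with the private keys of the coalition and from what the coalition has received. -/
def IsByzantine (T : Trace σ) (B : Finset (Fin n)) (p : Fin n) : Prop :=
  ∀ c s j, ∀ m ∈ T.sent p c s j, Derivable (B : Set (Fin n)) (T.received B s) m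

/-- `p` behaves as a deceitful process: it equivocates between the camps, by following the protocol
towards each of them in a separate copy, and does not deviate in any other way. The copies may have
different proposals `w c` and may learn of messages at different times; each copy receives, within
the delays of the partially synchronous network, everything that non-faulty and other faulty
processes send to `p`, where other deceitful processes show themselves by the copy for the same
camp. If all copies do the same, then `p` follows the protocol towards everybody. -/
def IsDeceitful (T : Trace σ) (p : Fin n) : Prop :=
  ∃ (w : Fin n → V) (r : Fin n → σ.Seed),
    ∀ c s j, T.sent p c s j = σ.send p (w c) (r c) (T.history p c s) j

/-- `p` behaves as a benign process: it may deviate from the protocol in any way, for instance by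
crashing or by sending stale or invalid messages, but it never sends conflicting messages. -/
def IsBenign (Δ : ℕ) (T : Trace σ) (p : Fin n) : Prop :=
  (∀ c s j, ∀ m ∈ T.sent p c s j, Derivable {p} (T.received {p} s) m) ∧
  ∀ m m', T.Sends p m → T.Sends p m' → ¬ Conflicting σ Δ p m m'

end Trace

/-- The set `E_σ(t, d, q)` of the executions of `σ` with up to `t` Byzantine, `d` deceitful and `q`
benign processes. -/
def Executions (σ : Protocol n V) (Δ t d q : ℕ) : Set (Trace σ) :=
  {T | T.IsRun Δ ∧ ∃ B D Q : Finset (Fin n),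
    T.faulty = B ∪ D ∪ Q ∧ Disjoint B D ∧ Disjoint B Q ∧ Disjoint D Q ∧
    B.card ≤ t ∧ D.card ≤ d ∧ Q.card ≤ q ∧
    (∀ p ∈ B, T.IsByzantine B p) ∧ (∀ p ∈ D, T.IsDeceitful p) ∧ ∀ p ∈ Q, T.IsBenign Δ p}

/-- `σ` tolerates `t` Byzantine, `d` deceitful and `q` benign processes: it solves consensus in all
executions of `E_σ(t, d, q)`. -/
def Tolerates (σ : Protocol n V) (Δ t d q : ℕ) : Prop :=
  ∀ T ∈ Executions σ Δ t d q, T.Termination ∧ T.Agreement ∧ T.Validity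

/-- Deceitful behaviour can prevent termination, in the sense in which faulty processes generally
can: if termination is prevented at all when the `d` faulty processes besides the `t` Byzantine and
`q` benign ones commit termination faults (that is, behave as benign processes), then it is also
prevented when they behave as deceitful processes. This holds in particular if some execution in
`E_σ(t, d, q)` does not terminate. -/
def DeceitfulCanBlock (σ : Protocol n V) (Δ t d q : ℕ) : Prop :=
  (∃ T ∈ Executions σ Δ t 0 (q + d), ¬ T.Termination) →
    ∃ T ∈ Executions σ Δ t d q, ¬ T.Termination

/-- Active accountability, in the presence of `t` Byzantine, `d` deceitful and `q` benign
processes: deceitful behaviour does not prevent termination. -/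
def ActiveAccountability (σ : Protocol n V) (Δ t d q : ℕ) : Prop :=
  ¬ DeceitfulCanBlock σ Δ t d q

end BDB

/-!
The proof is a partition argument. Suppose that `σ` tolerates `t`, `d`, `q` although deceitful
behaviour can block it. Then all executions of `E_σ(t, d, q)` terminate, hence so do all executions
of `E_σ(t, 0, q + d)`.

Let `P` be a group of processes with at most `t + d + q` processes outside it, all proposing `v`.
If the processes outside `P` crash at the start, as Byzantine and benign ones, then the execution
lies in `E_σ(t, 0, q + d)`, and so `P` decides in finite time. Up to that time the members of `P`
cannot tell this execution from a fault-free one in which everybody proposes `v` and the processes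
outside `P` are merely slow. There validity applies, and so `P` decides `v`. Thus an isolated group
`P` always decides its common proposal (`Tolerates.exists_decides_of_isolated`). The detour through
the fault-free execution is needed, because nothing but termination is known in `E_σ(t, 0, q + d)`.

As `n ≤ 3 (t + d) + 2 q`, the processes split into two nonempty camps `A` and `B` of at most
`t + d + q` processes each and a set `C` of at most `t + d` processes (`exists_camps`). Let `A`
propose `v` and `B` propose another value `v'`, let `C` equivocate between the two camps by running
an honest copy of `σ` towards each of them, and let the messages between `A` and `B` be slow. For
`A` this looks as if `A ∪ C` were isolated, and for `B` as if `B ∪ C` were. So `A` decides `v` and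
`B` decides `v'`, which violates agreement in `E_σ(t, d, 0) ⊆ E_σ(t, d, q)`.
-/

namespace BDB

/-! ### Derivability -/

theorem Derivable.mono {n : ℕ} {D : Type*} {K K' : Set (Fin n)} {S S' : Set (Message n D)}
    (hK : K ⊆ K') (hS : S ⊆ S') {m : Message n D} (h : Derivable K S m) : Derivable K' S' m := by
  induction h with
  | received h => exact .received (hS h)
  | data x => exact .data x
  | pair _ _ ha hb => exact .pair ha hb
  | fst _ h => exact .fst h
  | snd _ h => exact .snd h
  | content _ h => exact .content h
  | sign hi _ h => exact .sign (hK hi) h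

/-- Messages that the protocol prescribes can be constructed by every coalition that contains the
sender. -/
theorem Trace.derivable_of_mem_send {n : ℕ} {V : Type*} {σ : Protocol n V} (T : Trace σ)
    {K : Set (Fin n)} {p : Fin n} (hp : p ∈ K) (v : V) (r : σ.Seed) (c : Fin n) (s : ℕ)
    (j : Fin n) {m : Message n σ.Data} (hm : m ∈ σ.send p v r (T.history p c s) j) :
    Derivable K (T.received K s) m := by
  refine (σ.send_derivable _ _ _ _ _ m hm).mono (by simpa using hp) ?_
  rintro x ⟨b, hb, i, hx⟩
  simp only [Trace.history, List.mem_map, List.mem_range] at hb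
  obtain ⟨u, hu, rfl⟩ := hb
  exact ⟨p, hp, c, u, by omega, i, hx⟩

/-! ### Simulated executions -/

/-- An adversary that lets each process either be silent or run honest copies of `σ`. A faulty
process runs one copy per camp, and a non-faulty one only the copy of its own camp; the proposal of
a copy is determined by its camp. Messages from the processes in `slow c` in the dealings of camp
`c` are not delivered before `gst`; all other messages take one time step. -/
structure Scenario {n : ℕ} {V : Type*} (σ : Protocol n V) where
  faulty : Finset (Fin n)
  silent : Finset (Fin n)
  camp : Fin n → Fin n
  proposal : Fin n → V
  seed : Fin n → σ.Seed
  gst : ℕ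
  slow : Fin n → Finset (Fin n)

namespace Scenario

variable {n : ℕ} {V : Type*} {σ : Protocol n V} (E : Scenario σ)

/-- The camp whose dealings determine what `p` sends to camp `c`. -/
def copy (p c : Fin n) : Fin n := if p ∈ E.faulty then c else E.camp p

/-- The time at which a message of `i`, sent at time `s` to camp `c`, is delivered. -/
def delay (i : Fin n) (s : ℕ) (c : Fin n) : ℕ :=
  if i ∈ E.slow c then max s E.gst + 1 else s + 1

/-- The messages sent at time `s`. What has been received up to time `s` was sent before, so that
this is a recursion on `s`; the test `s' < s` holds whenever it is evaluated, and serves only to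
make the recursion visibly well-founded. -/
def sentAt (s : ℕ) (p c j : Fin n) : Multiset (Message n σ.Data) :=
  if p ∈ E.silent then 0 else
    σ.send p (E.proposal (E.copy p c)) (E.seed p)
      ((List.range (s + 1)).map fun u i => (Multiset.range u).bind fun s' =>
        (if _h : s' < s then sentAt s' i (E.copy p c) p else 0).filter
          fun _ => E.delay i s' (E.copy p c) = u) j
termination_by s

/-- The execution that the scenario brings about. -/
def trace : Trace σ where
  faulty := E.faulty
  camp := E.camp
  input p := E.proposal (E.camp p)
  seed := E.seed
  gst := E.gst
  sent p c s j := E.sentAt s p c j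
  delivery i s _ c _ := E.delay i s c

theorem trace_sent_of_mem {p : Fin n} (hp : p ∈ E.silent) (c : Fin n) (s : ℕ) (j : Fin n) :
    E.trace.sent p c s j = 0 := by
  simp only [trace]
  rw [sentAt, if_pos hp]

theorem trace_sent {p : Fin n} (hp : p ∉ E.silent) (c : Fin n) (s : ℕ) (j : Fin n) :
    E.trace.sent p c s j = σ.send p (E.proposal (E.copy p c)) (E.seed p)
      (E.trace.history p (E.copy p c) s) j := by
  simp only [trace, Trace.history]
  rw [sentAt, if_neg hp]
  congr 1
  refine List.map_congr_left fun u hu => ?_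
  have hu : u < s + 1 := List.mem_range.1 hu
  funext i
  refine Multiset.bind_congr fun s' hs' => ?_
  have hs' : s' < u := Multiset.mem_range.1 hs'
  rw [dif_pos (by omega)]

/-- Every message sent in a scenario can be constructed by every coalition that contains its
sender. -/
theorem derivable {K : Set (Fin n)} {p : Fin n} (hp : p ∈ K) {c : Fin n} {s : ℕ} {j : Fin n}
    {m : Message n σ.Data} (hm : m ∈ E.trace.sent p c s j) :
    Derivable K (E.trace.received K s) m := by
  by_cases h : p ∈ E.silent
  · simp [E.trace_sent_of_mem h] at hm
  · rw [E.trace_sent h] at hm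
    exact E.trace.derivable_of_mem_send hp _ _ _ _ _ hm

theorem isRun {Δ : ℕ} (hΔ : 1 ≤ Δ) (hs : E.silent ⊆ E.faulty) : E.trace.IsRun Δ where
  causal i s p c m := by
    simp only [trace, delay]
    split_ifs <;> omega
  partially_synchronous i s p c m := by
    simp only [trace, delay]
    split_ifs <;> omega
  follows p hp c s j := by
    replace hp : p ∉ E.faulty := hp
    rw [E.trace_sent fun h => hp (hs h), copy, if_neg hp]
    rfl
  unforgeable p hp c s j m hm := E.derivable (by exact_mod_cast hp) hm

theorem isByzantine {B : Finset (Fin n)} {p : Fin n} (hp : p ∈ B) : E.trace.IsByzantine B p :=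
  fun _ _ _ _ hm => E.derivable (by exact_mod_cast hp) hm

theorem isDeceitful {p : Fin n} (hf : p ∈ E.faulty) (hp : p ∉ E.silent) :
    E.trace.IsDeceitful p := by
  refine ⟨E.proposal, fun _ => E.seed p, fun c s j => ?_⟩
  rw [E.trace_sent hp, copy, if_pos hf]

theorem isBenign {p : Fin n} (hp : p ∈ E.silent) (Δ : ℕ) : E.trace.IsBenign Δ p := by
  refine ⟨fun c s j m hm => E.derivable (Set.mem_singleton p) hm, ?_⟩
  rintro m m' ⟨c, s, j, hm⟩
  simp [E.trace_sent_of_mem hp] at hm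

end Scenario

/-! ### Isolated groups of processes -/

/-- In the dealings of camp `c`, the processes in `P` follow the protocol with common proposal `v`
and seeds `r`, their messages to one another take one time step, and up to time `G` they receive
nothing from outside `P`. -/
structure Trace.Isolated {n : ℕ} {V : Type*} {σ : Protocol n V} (T : Trace σ)
    (P : Finset (Fin n)) (c : Fin n) (v : V) (r : Fin n → σ.Seed) (G : ℕ) : Prop where
  sent_eq : ∀ p ∈ P, ∀ s j, T.sent p c s j = σ.send p v (r p) (T.history p c s) j
  delivery_eq : ∀ i ∈ P, ∀ p ∈ P, ∀ s m, T.delivery i s p c m = s + 1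
  lt_delivery : ∀ i ∉ P, ∀ p ∈ P, ∀ s, ∀ m ∈ T.sent i c s p, G < T.delivery i s p c m

namespace Trace.Isolated

variable {n : ℕ} {V : Type*} {σ : Protocol n V} {T T' : Trace σ} {P : Finset (Fin n)}
  {c c' : Fin n} {v : V} {r : Fin n → σ.Seed} {G : ℕ}

/-- What an isolated group receives does not depend on the rest of the execution. -/
theorem inbox_eq (h : T.Isolated P c v r G) (h' : T'.Isolated P c' v r G) (s : ℕ) :
    s ≤ G → ∀ p ∈ P, T.inbox p c s = T'.inbox p c' s := by
  induction s using Nat.strong_induction_on with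
  | _ s ih =>
  intro hs p hp
  funext i
  refine Multiset.bind_congr fun s' hs' => ?_
  have hs' : s' < s := Multiset.mem_range.1 hs'
  by_cases hi : i ∈ P
  · have hist : T.history i c s' = T'.history i c' s' :=
      List.map_congr_left fun u hu => by
        have hu : u < s' + 1 := List.mem_range.1 hu
        exact ih u (by omega) (by omega) i hi
    simp only [h.sent_eq i hi, h'.sent_eq i hi, h.delivery_eq i hi p hp,
      h'.delivery_eq i hi p hp, hist]
  · rw [Multiset.filter_eq_nil.2 fun m hm => ((h.lt_delivery i hi p hp s' m hm).trans_le'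
        hs).ne', Multiset.filter_eq_nil.2 fun m hm =>
        ((h'.lt_delivery i hi p hp s' m hm).trans_le' hs).ne']

theorem decision_eq (h : T.Isolated P c v r G) (h' : T'.Isolated P c' v r G) {p : Fin n}
    (hp : p ∈ P) (hc : T.camp p = c) (hc' : T'.camp p = c') (hi : T.input p = T'.input p)
    (hr : T.seed p = T'.seed p) {s : ℕ} (hs : s ≤ G) : T.decision p s = T'.decision p s := by
  have hist : T.history p c s = T'.history p c' s :=
    List.map_congr_left fun u hu => by
      have hu : u < s + 1 := List.mem_range.1 hu
      exact h.inbox_eq h' u (by omega) p hp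
  rw [decision, decision, hc, hc', hist, hi, hr]

end Trace.Isolated

theorem _root_.Finset.exists_disjoint_union_of_card_le {α : Type*} [DecidableEq α] {F : Finset α}
    {x y : ℕ} (h : F.card ≤ x + y) :
    ∃ X Y : Finset α, F = X ∪ Y ∧ Disjoint X Y ∧ X.card ≤ x ∧ Y.card ≤ y := by
  obtain ⟨X, hX, hc⟩ := Finset.exists_subset_card_eq (Nat.min_le_right x F.card)
  refine ⟨X, F \ X, (Finset.union_sdiff_of_subset hX).symm, Finset.disjoint_sdiff, by omega, ?_⟩
  rw [Finset.card_sdiff_of_subset hX]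
  omega

/-- If at most `t + d + q` processes are outside `P`, and `P` is isolated for long enough, then its
members decide their common proposal. -/
theorem Tolerates.exists_decides_of_isolated {n : ℕ} {V : Type*} {σ : Protocol n V}
    {Δ t d q : ℕ} (hΔ : 1 ≤ Δ) (htol : Tolerates σ Δ t d q)
    (hterm : ∀ T ∈ Executions σ Δ t 0 (q + d), T.Termination)
    {P : Finset (Fin n)} (hP : Pᶜ.card ≤ t + d + q) (v : V) (r : Fin n → σ.Seed) :
    ∃ G₀, ∀ G ≥ G₀, ∀ (T : Trace σ) (c : Fin n), T.Isolated P c v r G → ∀ p ∈ P,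
      T.camp p = c → T.input p = v → T.seed p = r p → T.Decides p v := by
  rcases P.eq_empty_or_nonempty with rfl | ⟨a, -⟩
  · exact ⟨0, by simp⟩
  -- `X`: the processes outside `P` crash at the start.
  let X : Scenario σ := ⟨Pᶜ, Pᶜ, fun _ => a, fun _ => v, r, 0, fun _ => ∅⟩
  have hX : X.trace.Termination := by
    obtain ⟨B, Q, hBQ, hdisj, hB, hQ⟩ :=
      Finset.exists_disjoint_union_of_card_le (x := t) (y := q + d) (hP.trans (by omega))
    refine hterm _ ⟨X.isRun hΔ subset_rfl, B, ∅, Q, ?_, by simp, hdisj, by simp, hB, by simp, hQ,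
      fun p hp => X.isByzantine hp, by simp, fun p hp => X.isBenign ?_ Δ⟩
    · rw [Finset.union_empty]
      exact hBQ
    · show p ∈ Pᶜ
      rw [hBQ]
      exact Finset.mem_union_right _ hp
  have hXiso (G : ℕ) : X.trace.Isolated P a v r G := by
    refine ⟨fun p hp s j => ?_, fun i hi p hp s m => by simp [X, Scenario.trace, Scenario.delay],
      fun i hi p hp s m hm => ?_⟩
    · rw [X.trace_sent (by simpa [X] using hp)]
      simp [X, Scenario.copy]
    · simp [X.trace_sent_of_mem (show i ∈ Pᶜ by simpa using hi)] at hm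
  have hdec : ∀ p, ∃ s, p ∈ P → ∃ w, X.trace.decision p s = some w ∧
      ∀ s' < s, X.trace.decision p s' = none := by
    intro p
    by_cases hp : p ∈ P
    · obtain ⟨w, s, h⟩ := hX p (by simpa [X, Scenario.trace] using hp)
      exact ⟨s, fun _ => ⟨w, h⟩⟩
    · exact ⟨0, fun h => absurd h hp⟩
  choose τ hτ using hdec
  refine ⟨Finset.univ.sup τ, fun G hG T c hT p hp hc hi hr => ?_⟩
  have hτG : τ p ≤ G := (Finset.le_sup (Finset.mem_univ p)).trans hG
  obtain ⟨w, hw, hlt⟩ := hτ p hp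
  have transfer : ∀ (T : Trace σ) (c : Fin n), T.Isolated P c v r G → T.camp p = c →
      T.input p = v → T.seed p = r p → T.Decides p w := by
    intro T c hT hc hi hr
    have key : ∀ s ≤ G, T.decision p s = X.trace.decision p s := fun s hs =>
      hT.decision_eq (hXiso G) hp hc rfl hi hr hs
    exact ⟨τ p, (key _ hτG).trans hw, fun s' hs' => (key _ (by omega)).trans (hlt s' hs')⟩
  -- `N`: nobody is faulty, everybody proposes `v`, and the processes outside `P` are slow.
  let N : Scenario σ := ⟨∅, ∅, fun _ => a, fun _ => v, r, G, fun _ => Pᶜ⟩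
  have hNiso : N.trace.Isolated P a v r G := by
    refine ⟨fun p hp s j => ?_, fun i hi p hp s m => ?_, fun i hi p hp s m hm => ?_⟩
    · rw [N.trace_sent (by simp [N])]
      simp [N, Scenario.copy]
    · simp [N, Scenario.trace, Scenario.delay, hi]
    · simp [N, Scenario.trace, Scenario.delay, hi]
  have hN : N.trace.Validity := (htol _ ⟨N.isRun hΔ subset_rfl, ∅, ∅, ∅, by
    simp [N, Scenario.trace]⟩).2.2
  have hwv : w = v := hN v (fun _ _ => rfl) p (by simp [N, Scenario.trace]) w
    (transfer N.trace a hNiso rfl rfl rfl)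
  exact hwv ▸ transfer T c hT hc hi hr

/-! ### Two camps -/

/-- The bound on `n` allows two nonempty camps that are small enough to crash, and equivocating
processes in between. -/
theorem exists_camps {n k q : ℕ} (hn : 2 ≤ n) (h : n ≤ 3 * k + 2 * q) :
    ∃ A B : Finset (Fin n), A.Nonempty ∧ B.Nonempty ∧ Disjoint A B ∧ A.card ≤ k + q ∧
      B.card ≤ k + q ∧ (A ∪ B)ᶜ.card ≤ k := by
  -- `C` is as large as possible with two processes left over; the rest is halved.
  obtain ⟨C, -, hC⟩ := Finset.exists_subset_card_eq (s := (Finset.univ : Finset (Fin n)))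
    (n := min k (n - 2)) (by simp)
  have hC' : Cᶜ.card = n - min k (n - 2) := by rw [Finset.card_compl, hC, Fintype.card_fin]
  obtain ⟨A, hA, hAc⟩ := Finset.exists_subset_card_eq (Nat.div_le_self Cᶜ.card 2)
  have hB := Finset.card_sdiff_of_subset hA
  refine ⟨A, Cᶜ \ A, ?_, ?_, Finset.disjoint_sdiff, by omega, by omega, ?_⟩
  · exact Finset.card_pos.1 (by omega)
  · exact Finset.card_pos.1 (by omega)
  · rw [Finset.union_sdiff_of_subset hA, compl_compl]
    omega

end BDB

theorem mainTheorem10 {n : ℕ} {V : Type*} [Nontrivial V] (hn : 2 ≤ n) (Δ : ℕ) (hΔ : 1 ≤ Δ)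
    (σ : BDB.Protocol n V) (t d q : ℕ) (hσ : ¬ BDB.ActiveAccountability σ Δ t d q)
    (h : n ≤ 3 * (t + d) + 2 * q) : ¬ BDB.Tolerates σ Δ t d q := by
  open BDB in
  intro htol
  have hterm : ∀ T ∈ Executions σ Δ t 0 (q + d), T.Termination := by
    intro T hT
    by_contra hnot
    obtain ⟨T', hT', hnot'⟩ := not_not.1 hσ ⟨T, hT, hnot⟩
    exact hnot' (htol T' hT').1
  obtain ⟨v, v', hv⟩ := exists_pair_ne V
  let r : Fin n → σ.Seed := fun _ => σ.seed_nonempty.some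
  obtain ⟨A, B, ⟨a, ha⟩, ⟨b, hb⟩, hAB, hA, hB, hC⟩ := exists_camps hn h
  have haB : a ∉ B := Finset.disjoint_left.1 hAB ha
  have hbA : b ∉ A := Finset.disjoint_right.1 hAB hb
  have hab : a ≠ b := fun e => haB (e ▸ hb)
  obtain ⟨G₁, hG₁⟩ := htol.exists_decides_of_isolated hΔ hterm (P := Bᶜ) (by simpa using hB) v r
  obtain ⟨G₂, hG₂⟩ := htol.exists_decides_of_isolated hΔ hterm (P := Aᶜ) (by simpa using hA) v' r
  -- Camp `A` is labelled `a`, camp `B` is labelled `b`, and all others equivocate.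
  let Y : Scenario σ := ⟨(A ∪ B)ᶜ, ∅, fun p => if p ∈ B then b else a,
    fun c => if c = b then v' else v, r, max G₁ G₂, fun c => if c = b then A else B⟩
  have hY : Y.trace.Agreement := by
    obtain ⟨K, D, hKD, hdisj, hK, hD⟩ := Finset.exists_disjoint_union_of_card_le hC
    refine (htol _ ⟨Y.isRun hΔ (Finset.empty_subset _), K, D, ∅, ?_, hdisj, by simp, by simp, hK,
      hD, by simp, fun p hp => Y.isByzantine hp, fun p hp => Y.isDeceitful ?_ (by simp [Y]),
      by simp⟩).2.1
    · rw [Finset.union_empty]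
      exact hKD
    · show p ∈ (A ∪ B)ᶜ
      rw [hKD]
      exact Finset.mem_union_right _ hp
  have isoA : Y.trace.Isolated Bᶜ a v r (max G₁ G₂) := by
    refine ⟨fun p hp s j => ?_, fun i hi p hp s m => ?_, fun i hi p hp s m hm => ?_⟩
    · have hcopy : Y.copy p a = a := by
        simp [Y, Scenario.copy, Finset.mem_compl.1 hp]
      rw [Y.trace_sent (by simp [Y]), hcopy]
      simp [Y, hab]
    · simp [Y, Scenario.trace, Scenario.delay, hab, Finset.mem_compl.1 hi]
    · have hi : i ∈ B := by simpa using hi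
      simp only [Y, Scenario.trace, Scenario.delay, hab, hi, if_true, if_false]
      omega
  have isoB : Y.trace.Isolated Aᶜ b v' r (max G₁ G₂) := by
    refine ⟨fun p hp s j => ?_, fun i hi p hp s m => ?_, fun i hi p hp s m hm => ?_⟩
    · have hcopy : Y.copy p b = b := by
        simp only [Y, Scenario.copy, Finset.mem_compl, Finset.mem_union, Finset.mem_compl.1 hp,
          false_or]
        split_ifs <;> rfl
      rw [Y.trace_sent (by simp [Y]), hcopy]
      simp [Y]
    · simp [Y, Scenario.trace, Scenario.delay, Finset.mem_compl.1 hi]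
    · have hi : i ∈ A := by simpa using hi
      simp only [Y, Scenario.trace, Scenario.delay, hi, if_true]
      omega
  have hda : Y.trace.Decides a v := hG₁ _ (le_max_left _ _) _ a isoA a (by simpa using haB)
    (by simp [Y, Scenario.trace, haB]) (by simp [Y, Scenario.trace, haB, hab]) rfl
  have hdb : Y.trace.Decides b v' := hG₂ _ (le_max_right _ _) _ b isoB b (by simpa using hbA)
    (by simp [Y, Scenario.trace, hb]) (by simp [Y, Scenario.trace, hb]) rfl
  exact hv (hY a (by simp [Y, Scenario.trace, ha]) b (by simp [Y, Scenario.trace, hb]) v v' hda hdb)
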